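/- Let $\Sigma$ be a closed (compact, connected) Riemann surface of genus $g>1$, let $U_0$ be a holomorphic cubic differential on $\Sigma$ which is not identically zero, and let $K\subset\Sigma$ be a compact subset containing no zero of $U_0$. Then there is a constant $C=C(\Sigma,U_0,K)$ such that the following holds for every smooth conformal background metric $h$ on $\Sigma$ and every real $\lambda>0$. Put $U=\lambda U_0$ and let $u=u_\lambda:\Sigma\to\mathbb{R}$ be a $C^2$ solution of Wang's equation $$\Delta u + 4e^{-2u}\|U\|^2 - 2e^u - 2\kappa = 0 .$$ Here, if $h=\rho\,|dz|^2$ and $U=U(z)\,dz^3$ in a local conformal coordinate $z=x+iy$, then $\Delta=\rho^{-1}(\partial_x^2+\partial_y^2)$ is the Laplacian of $h$, $\|U\|^2=|U(z)|^2\rho^{-3}$ is the squared norm of $U$ with respect to $h$, and $\kappa=-\tfrac12\Delta\log\rho$ is the Gauss curvature of $h$. Then at every point of $K$ $$\frac12 \;\ge\; \|U\|^2e^{-3u_\lambda} \;\ge\; \frac12 - C\lambda^{-2/3}.$$ -/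

import Mathlib

open scoped Manifold ContDiff

noncomputable section

namespace RiemannSurface

/-- The genus of a closed surface: half the rank of its first integral singular homology group. -/
def genus.{v} (X : Type v) [TopologicalSpace X] : ℕ :=
  Module.finrank ℤ
    (((AlgebraicTopology.singularHomologyFunctor (ModuleCat.{v} ℤ) 1).obj
      (ModuleCat.of ℤ (ULift.{v} ℤ))).obj (TopCat.of X)) / 2

variable (X : Type*) [TopologicalSpace X] [ChartedSpace ℂ X]

/-- A holomorphic cubic differential, given in each chart `z` of the atlas as `U(z) dz³` with `U`
holomorphic on the image of the chart. -/
structure CubicDifferential where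
  /-- The coefficient `U(z)` of `dz³` in the coordinate `z` given by a chart. -/
  coeff : atlas ℂ X → ℂ → ℂ
  holomorphic : ∀ e : atlas ℂ X, DifferentiableOn ℂ (coeff e) e.1.target
  transform : ∀ e e' : atlas ℂ X, ∀ x ∈ e.1.source ∩ e'.1.source,
    coeff e (e.1 x) = coeff e' (e'.1 x) * deriv (e'.1 ∘ e.1.symm) (e.1 x) ^ 3

/-- A smooth conformal Riemannian metric, given in each chart `z` of the atlas as `ρ(z) |dz|²`
with `ρ` smooth and positive on the image of the chart. -/
structure ConformalMetric where
  /-- The coefficient `ρ(z)` of `|dz|²` in the coordinate `z` given by a chart. -/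
  density : atlas ℂ X → ℂ → ℝ
  smooth : ∀ e : atlas ℂ X, ContDiffOn ℝ ∞ (density e) e.1.target
  pos : ∀ e : atlas ℂ X, ∀ z ∈ e.1.target, 0 < density e z
  transform : ∀ e e' : atlas ℂ X, ∀ x ∈ e.1.source ∩ e'.1.source,
    density e (e.1 x) = density e' (e'.1 x) * ‖deriv (e'.1 ∘ e.1.symm) (e.1 x)‖ ^ 2

variable {X}

/-- The preferred chart at `x`, as an element of the atlas. The pointwise quantities below are
computed in this chart; each of them is independent of the choice of a chart around `x`. -/
def chart (x : X) : atlas ℂ X := ⟨chartAt ℂ x, chart_mem_atlas ℂ x⟩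

namespace CubicDifferential

/-- The multiple `c U` of a cubic differential by a complex constant. -/
instance : SMul ℂ (CubicDifferential X) where
  smul c U :=
    { coeff := fun e z => c * U.coeff e z
      holomorphic := fun e => (U.holomorphic e).const_mul c
      transform := fun e e' x hx => by rw [U.transform e e' x hx, mul_assoc] }

/-- The point `x` is a zero of `U`. -/
def IsZeroAt (U : CubicDifferential X) (x : X) : Prop :=
  U.coeff (chart x) ((chart x).1 x) = 0

end CubicDifferential

namespace ConformalMetric

/-- The pointwise squared norm `‖U‖² = |U(z)|² / ρ(z)³` of a cubic differential. -/
def normSq (h : ConformalMetric X) (U : CubicDifferential X) (x : X) : ℝ :=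
  ‖U.coeff (chart x) ((chart x).1 x)‖ ^ 2 / h.density (chart x) ((chart x).1 x) ^ 3

/-- The Laplace-Beltrami operator `Δ u = ρ⁻¹ (∂²u/∂x² + ∂²u/∂y²)`, where `z = x + iy`. -/
def laplacian (h : ConformalMetric X) (u : X → ℝ) (x : X) : ℝ :=
  Laplacian.laplacian (u ∘ (chart x).1.symm) ((chart x).1 x) /
    h.density (chart x) ((chart x).1 x)

/-- The Gauss curvature `κ = -(2ρ)⁻¹ (∂²/∂x² + ∂²/∂y²) log ρ`. -/
def gaussCurvature (h : ConformalMetric X) (x : X) : ℝ :=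
  -(Laplacian.laplacian (fun z => Real.log (h.density (chart x) z)) ((chart x).1 x) /
    (2 * h.density (chart x) ((chart x).1 x)))

/-- The function `u` is a classical (twice continuously differentiable) solution of Wang's
equation `Δu + 4 e^{-2u} ‖U‖² - 2 e^u - 2κ = 0` with respect to the background metric `h`. -/
def IsWangSolution (h : ConformalMetric X) (U : CubicDifferential X) (u : X → ℝ) : Prop :=
  ContMDiff 𝓘(ℝ, ℂ) 𝓘(ℝ, ℝ) 2 u ∧
    ∀ x : X, h.laplacian u x + 4 * Real.exp (-2 * u x) * h.normSq U x
      - 2 * Real.exp (u x) - 2 * h.gaussCurvature x = 0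

end ConformalMetric

end RiemannSurface

end

/-! Write `T = ‖U‖² e^{-3u}` and, in a coordinate `z`, `P = ρ e^u`. Away from the zeros of `U`, `log
|U(z)|` is harmonic and the curvature term of Wang's equation cancels against `Δ log ρ`, so in the
flat Laplacian `Δ log T = 6 P (2T - 1)`. At a maximum of `T` the left side is nonpositive, whence `T
≤ 1/2` (`IsWangSolution.ratio_le_half`).

For the lower bound put `f = -log (2T) ≥ 0`. Then `Δ f = 6 P (1 - e^{-f})` and `P³ = 2 |U(z)|² e^f`.
On a disc where `2 |U(z)|² ≥ k³` this gives `Δ f ≥ (k/3) f²`, a Keller–Osserman inequality: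
comparison with a barrier infinite on the boundary bounds `f` at the centre by a multiple of `1 / (k
R²)`, with no boundary data (`neg_log_ratio_le_of_closedBall`). For `U = λ U₀` one may take `k`
proportional to `λ^{2/3}`, and `T ≥ 1/2 - f/2` gives the rate. The metric enters only through `P`,
which is eliminated, so the constant does not depend on it. Compactness of `K` makes it uniform. -/

section

/-! ### Second derivatives and the Laplacian of the plane. -/

open Filter Topology Laplacian

/-- The second derivative of `f` in the direction `v`, computed along a line. -/
theorem fderiv_fderiv_eq_of_hasDerivAt_line {E : Type*} [NormedAddCommGroup E] [NormedSpace ℝ E]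
    {f : E → ℝ} {z v : E} (hf : ContDiffAt ℝ 2 f z) {g : ℝ → ℝ} {a : ℝ}
    (hg : ∀ᶠ t in 𝓝 (0 : ℝ), HasDerivAt (fun t : ℝ => f (z + t • v)) (g t) t)
    (ha : HasDerivAt g a 0) : fderiv ℝ (fderiv ℝ f) z v v = a := by
  have hline : ∀ t : ℝ, HasDerivAt (fun t : ℝ => z + t • v) v t := fun t => by
    simpa using ((hasDerivAt_id t).smul_const v).const_add z
  have htend : Tendsto (fun t : ℝ => z + t • v) (𝓝 0) (𝓝 z) := by
    simpa using (hline 0).continuousAt.tendsto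
  have hev : ∀ᶠ t in 𝓝 (0 : ℝ), DifferentiableAt ℝ f (z + t • v) :=
    htend.eventually ((hf.eventually (by simp)).mono fun y hy => hy.differentiableAt (by simp))
  have hg' : (fun t : ℝ => fderiv ℝ f (z + t • v) v) =ᶠ[𝓝 0] g := by
    filter_upwards [hg, hev] with t h1 h2
    exact (h2.hasFDerivAt.comp_hasDerivAt t (hline t)).unique h1
  have h2 : DifferentiableAt ℝ (fderiv ℝ f) z :=
    (hf.fderiv_right (m := 1) (by norm_num)).differentiableAt (by simp)
  have h3 : HasDerivAt (fun t : ℝ => fderiv ℝ f (z + t • v)) (fderiv ℝ (fderiv ℝ f) z v) 0 := by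
    have h4 : HasFDerivAt (fderiv ℝ f) (fderiv ℝ (fderiv ℝ f) z) (z + (0 : ℝ) • v) := by
      simpa using h2.hasFDerivAt
    exact h4.comp_hasDerivAt (0 : ℝ) (hline 0)
  have h5 : HasDerivAt (fun t : ℝ => fderiv ℝ f (z + t • v) v)
      (fderiv ℝ (fderiv ℝ f) z v v) 0 := by
    simpa using h3.clm_apply (hasDerivAt_const (0 : ℝ) v)
  exact (h5.congr_of_eventuallyEq hg'.symm).unique ha

/-- Were the second derivative along a line positive, the point would also be a local minimum on
that line; the restriction would be locally constant and its second derivative zero. -/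
theorem IsLocalMax.fderiv_fderiv_nonpos {E : Type*} [NormedAddCommGroup E] [NormedSpace ℝ E]
    {f : E → ℝ} {z : E} (hmax : IsLocalMax f z) (hf : ContDiffAt ℝ 2 f z) (v : E) :
    fderiv ℝ (fderiv ℝ f) z v v ≤ 0 := by
  by_contra! hpos
  have hline : ContDiff ℝ 2 (fun t : ℝ => z + t • v) := by fun_prop
  have htend : Tendsto (fun t : ℝ => z + t • v) (𝓝 0) (𝓝 z) := by
    simpa using hline.continuous.tendsto 0
  set φ : ℝ → ℝ := fun t => f (z + t • v) with hφ
  have hφ2 : ContDiffAt ℝ 2 φ 0 := by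
    refine ContDiffAt.comp (0 : ℝ) (g := f) (f := fun t : ℝ => z + t • v) ?_ hline.contDiffAt
    simpa using hf
  have hφ1 : ∀ᶠ t in 𝓝 (0 : ℝ), HasDerivAt φ (deriv φ t) t :=
    (hφ2.eventually (by simp)).mono fun t ht => (ht.differentiableAt (by simp)).hasDerivAt
  have hφ' : HasDerivAt (deriv φ) (deriv (deriv φ) 0) 0 := by
    have : ContDiffAt ℝ 1 (deriv φ) 0 := by
      have h1 := (hφ2.fderiv_right (m := 1) (by norm_num)).clm_apply
        (contDiffAt_const (c := (1 : ℝ)))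
      exact h1
    exact (this.differentiableAt (by simp)).hasDerivAt
  have heq := fderiv_fderiv_eq_of_hasDerivAt_line hf hφ1 hφ'
  have hmaxφ : IsLocalMax φ 0 := by
    have : ∀ᶠ t in 𝓝 (0 : ℝ), f (z + t • v) ≤ f z := htend.eventually hmax
    filter_upwards [this] with t ht
    simpa [hφ] using ht
  have hminφ : IsLocalMin φ 0 :=
    isLocalMin_of_deriv_deriv_pos (heq ▸ hpos) hmaxφ.deriv_eq_zero hφ2.continuousAt
  have hconst : φ =ᶠ[𝓝 0] fun _ => φ 0 := by
    filter_upwards [hmaxφ, hminφ] with t h1 h2 using le_antisymm h1 h2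
  have h0 : deriv (deriv φ) 0 = 0 := by
    rw [hconst.deriv.deriv_eq]; simp
  linarith

theorem laplacian_complex_eq (f : ℂ → ℝ) (z : ℂ) :
    Δ f z = fderiv ℝ (fderiv ℝ f) z 1 1 + fderiv ℝ (fderiv ℝ f) z Complex.I Complex.I := by
  rw [InnerProductSpace.laplacian_eq_iteratedFDeriv_complexPlane]
  simp [iteratedFDeriv_two_apply]

theorem IsLocalMax.laplacian_nonpos {f : ℂ → ℝ} {z : ℂ} (hmax : IsLocalMax f z)
    (hf : ContDiffAt ℝ 2 f z) : Δ f z ≤ 0 := by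
  rw [laplacian_complex_eq]
  exact add_nonpos (hmax.fderiv_fderiv_nonpos hf 1) (hmax.fderiv_fderiv_nonpos hf Complex.I)

/-- Conformal covariance of the Laplacian of the plane. -/
theorem laplacian_comp_analyticAt {f : ℂ → ℝ} {τ : ℂ → ℂ} {w : ℂ} (hτ : AnalyticAt ℂ τ w)
    (hf : ContDiffAt ℝ 2 f (τ w)) : Δ (f ∘ τ) w = ‖deriv τ w‖ ^ 2 * Δ f (τ w) := by
  have hτ2 : ContDiffAt ℝ 2 τ w := (hτ.contDiffAt (n := 2)).restrict_scalars ℝ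
  have hcomp : ContDiffAt ℝ 2 (f ∘ τ) w := hf.comp w hτ2
  set B := fderiv ℝ (fderiv ℝ f) (τ w) with hB
  -- Chain rule along a line. Summed over `v = 1` and `v = I`, the first-order terms cancel because
  -- `1² + I² = 0`.
  have key : ∀ v : ℂ, fderiv ℝ (fderiv ℝ (f ∘ τ)) w v v =
      B (v * deriv τ w) (v * deriv τ w) + fderiv ℝ f (τ w) (v * (v * deriv (deriv τ) w)) := by
    intro v
    have hline : ∀ t : ℝ, HasDerivAt (fun t : ℝ => w + t • v) v t := fun t => by
      simpa using ((hasDerivAt_id t).smul_const v).const_add w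
    have htend : Tendsto (fun t : ℝ => w + t • v) (𝓝 0) (𝓝 w) := by
      simpa using (hline 0).continuousAt.tendsto
    have hd : ∀ σ : ℂ → ℂ, ∀ t : ℝ, DifferentiableAt ℂ σ (w + t • v) →
        HasDerivAt (fun t : ℝ => σ (w + t • v)) (v * deriv σ (w + t • v)) t := by
      intro σ t hσ
      have h := hσ.hasDerivAt.scomp t (hline t)
      rw [smul_eq_mul] at h
      exact h
    have h1 : ∀ᶠ t in 𝓝 (0 : ℝ), DifferentiableAt ℂ τ (w + t • v) :=
      htend.eventually (hτ.eventually_analyticAt.mono fun y hy => hy.differentiableAt)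
    have h2 : ∀ᶠ t in 𝓝 (0 : ℝ), DifferentiableAt ℝ f (τ (w + t • v)) :=
      (hτ.continuousAt.tendsto.comp htend).eventually
        ((hf.eventually (by simp)).mono fun y hy => hy.differentiableAt (by simp))
    refine fderiv_fderiv_eq_of_hasDerivAt_line hcomp
      (g := fun t => fderiv ℝ f (τ (w + t • v)) (v * deriv τ (w + t • v))) ?_ ?_
    · filter_upwards [h1, h2] with t a b
      exact b.hasFDerivAt.comp_hasDerivAt t (hd τ t a)
    · have h3 : DifferentiableAt ℝ (fderiv ℝ f) (τ (w + (0 : ℝ) • v)) := by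
        simpa using (hf.fderiv_right (m := 1) (by norm_num)).differentiableAt (by simp)
      have h4 := hd τ 0 h1.self_of_nhds
      have h5 := hd (deriv τ) 0 (by simpa using hτ.deriv.differentiableAt)
      have h6 : HasDerivAt (fun t : ℝ => fderiv ℝ f (τ (w + t • v)))
          (fderiv ℝ (fderiv ℝ f) (τ (w + (0 : ℝ) • v)) (v * deriv τ (w + (0 : ℝ) • v))) 0 :=
        h3.hasFDerivAt.comp_hasDerivAt (0 : ℝ) h4
      have h7 : HasDerivAt (fun t : ℝ => v * deriv τ (w + t • v))
          (v * (v * deriv (deriv τ) (w + (0 : ℝ) • v))) 0 := h5.const_mul v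
      refine (h6.clm_apply h7).congr_deriv ?_
      rw [zero_smul, add_zero]
  rw [laplacian_complex_eq, laplacian_complex_eq, key, key, ← hB]
  set a := deriv τ w with ha
  -- The images of `1` and `I` under multiplication by `a` are orthogonal of length `‖a‖`, so the
  -- mixed second derivatives cancel as well.
  have e1 : (1 : ℂ) * a = a.re • (1 : ℂ) + a.im • Complex.I := by
    apply Complex.ext <;> simp
  have e2 : Complex.I * a = (-a.im) • (1 : ℂ) + a.re • Complex.I := by
    apply Complex.ext <;> simp
  have e3 : Complex.I * (Complex.I * deriv (deriv τ) w) = -deriv (deriv τ) w := by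
    rw [← mul_assoc, Complex.I_mul_I]; simp
  rw [e1, e2, e3, ← Complex.normSq_eq_norm_sq, Complex.normSq_apply]
  simp only [map_add, map_smul, add_apply, smul_apply, smul_eq_mul, map_neg, one_mul]
  ring

/-! ### The disc barrier and the Keller–Osserman inequality. -/

theorem contDiffAt_disc_barrier {c z : ℂ} {R : ℝ} (hz : ‖z - c‖ < R) :
    ContDiffAt ℝ 2 (fun z : ℂ => ((R ^ 2 - ‖z - c‖ ^ 2) ^ 2)⁻¹) z := by
  have hs : 0 < R ^ 2 - ‖z - c‖ ^ 2 := by nlinarith [norm_nonneg (z - c)]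
  refine ContDiffAt.inv ?_ (by positivity)
  have : ContDiffAt ℝ 2 (fun z : ℂ => ‖z - c‖ ^ 2) z :=
    (contDiffAt_id.sub contDiffAt_const).norm_sq ℝ
  exact (contDiffAt_const.sub this).pow 2

/-- The Laplacian bound for the barrier `(R² - |z - c|²)⁻²` on a disc. -/
theorem laplacian_disc_barrier_le {c z : ℂ} {R : ℝ} (hz : ‖z - c‖ < R) :
    Δ (fun z : ℂ => ((R ^ 2 - ‖z - c‖ ^ 2) ^ 2)⁻¹) z ≤
      32 * R ^ 2 / (R ^ 2 - ‖z - c‖ ^ 2) ^ 4 := by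
  have hs : 0 < R ^ 2 - ‖z - c‖ ^ 2 := by nlinarith [norm_nonneg (z - c)]
  have hC := contDiffAt_disc_barrier hz
  set s := R ^ 2 - ‖z - c‖ ^ 2 with hs_def
  have key : ∀ v : ℂ, ‖v‖ = 1 →
      fderiv ℝ (fderiv ℝ (fun z : ℂ => ((R ^ 2 - ‖z - c‖ ^ 2) ^ 2)⁻¹)) z v v =
      24 * (inner ℝ (z - c) v) ^ 2 / s ^ 4 + 4 / s ^ 3 := by
    intro v hv
    set b := inner ℝ (z - c) v with hb
    have hexp : ∀ t : ℝ, R ^ 2 - ‖z + t • v - c‖ ^ 2 = s - 2 * b * t - t ^ 2 := by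
      intro t
      have : z + t • v - c = (z - c) + t • v := by ring
      rw [this, norm_add_sq_real, inner_smul_right, norm_smul, hv, ← hb, hs_def]
      simp only [mul_one, Real.norm_eq_abs, sq_abs]
      ring
    have hp : ∀ t : ℝ, HasDerivAt (fun t : ℝ => s - 2 * b * t - t ^ 2) (-(2 * b) - 2 * t) t := by
      intro t
      exact ((((hasDerivAt_id' t).const_mul (2 * b)).const_sub s).sub
        ((hasDerivAt_id' t).pow 2)).congr_deriv (by simp)
    have hcont : ∀ᶠ t in 𝓝 (0 : ℝ), 0 < s - 2 * b * t - t ^ 2 :=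
      (hp 0).continuousAt.eventually (lt_mem_nhds (by simpa using hs))
    refine fderiv_fderiv_eq_of_hasDerivAt_line hC
      (g := fun t => -2 * (-(2 * b) - 2 * t) / (s - 2 * b * t - t ^ 2) ^ 3) ?_ ?_
    · filter_upwards [hcont] with t ht
      simp only [hexp]
      refine (((hp t).pow 2).inv (pow_pos ht 2).ne').congr_deriv ?_
      have h0 := ht.ne'
      simp only [Pi.pow_apply]
      field_simp
      push_cast
      ring
    · have h1 : HasDerivAt (fun t : ℝ => -2 * (-(2 * b) - 2 * t)) 4 0 := by
        exact (((hasDerivAt_id' (0 : ℝ)).const_mul 2).const_sub (-(2 * b))).const_mul (-2)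
          |>.congr_deriv (by norm_num)
      refine (h1.div ((hp 0).pow 3) (by simpa using hs.ne')).congr_deriv ?_
      simp only [Pi.pow_apply, mul_zero, sub_zero, ne_eq, OfNat.ofNat_ne_zero, not_false_eq_true,
        zero_pow]
      field_simp
      push_cast
      ring
  have hin : inner ℝ (z - c) 1 ^ 2 + inner ℝ (z - c) Complex.I ^ 2 = ‖z - c‖ ^ 2 := by
    rw [← Complex.normSq_eq_norm_sq, Complex.normSq_apply]
    simp [Complex.inner]
    ring
  rw [laplacian_complex_eq, key 1 (by simp), key _ Complex.norm_I]
  have : 24 * inner ℝ (z - c) 1 ^ 2 / s ^ 4 + 4 / s ^ 3 +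
      (24 * inner ℝ (z - c) Complex.I ^ 2 / s ^ 4 + 4 / s ^ 3) =
      (24 * ‖z - c‖ ^ 2 + 8 * s) / s ^ 4 := by
    rw [← hin]; field_simp; ring
  rw [this]
  gcongr
  nlinarith [norm_nonneg (z - c)]

/-- An elementary form of the Keller–Osserman inequality: a cubic lower bound for `P` and an upper
bound for `P (1 - e^{-f})` bound `f`. -/
theorem sq_le_of_exp_bound {P f k Q : ℝ} (hP : 0 < P) (hk : 0 < k) (hf : 0 ≤ f)
    (hPk : k ^ 3 * Real.exp f ≤ P ^ 3) (hQ : P * (1 - Real.exp (-f)) ≤ Q) :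
    k * f ^ 2 ≤ 18 * Q := by
  have h1 : k * Real.exp (f / 3) ≤ P := by
    refine le_of_pow_le_pow_left₀ (n := 3) (by norm_num) hP.le ?_
    rw [mul_pow, ← Real.exp_nat_mul]
    have h0 : ((3 : ℕ) : ℝ) * (f / 3) = f := by push_cast; ring
    rwa [h0]
  have h2 : 0 ≤ 1 - Real.exp (-f) := by
    have := Real.exp_le_one_iff.mpr (neg_nonpos.mpr hf); linarith
  have h3 : k * Real.exp (f / 3) * (1 - Real.exp (-f)) ≤ Q :=
    (mul_le_mul_of_nonneg_right h1 h2).trans hQ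
  have h4 : Real.exp (f / 3) * Real.exp (-f) ≤ 1 := by
    rw [← Real.exp_add]; exact Real.exp_le_one_iff.mpr (by linarith)
  have h5 := Real.quadratic_le_exp_of_nonneg (x := f / 3) (by positivity)
  -- The right side is at least `e^{f/3} - 1` by `h4`, and `(f/3)² / 2 = f² / 18`.
  have h6 : f ^ 2 / 18 ≤ Real.exp (f / 3) * (1 - Real.exp (-f)) := by nlinarith
  have := mul_le_mul_of_nonneg_left h6 hk.le
  linarith

end

noncomputable section

/-! ### The ratio `‖U‖² e^{-3u}` in charts, its equation and the upper bound. -/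

open Filter Topology Laplacian

namespace RiemannSurface

variable {X : Type*} [TopologicalSpace X] [ChartedSpace ℂ X]

theorem mem_chart_source' (x : X) : x ∈ (chart x).1.source := mem_chart_source ℂ x

theorem analyticAt_transition [IsManifold 𝓘(ℂ, ℂ) ω X] (e e' : atlas ℂ X) {x : X}
    (hx : x ∈ e.1.source) (hx' : x ∈ e'.1.source) :
    AnalyticAt ℂ (e'.1 ∘ e.1.symm) (e.1 x) := by
  have h := contMDiffOn_of_mem_contDiffGroupoid
    ((contDiffGroupoid ω 𝓘(ℂ, ℂ)).compatible (M := X) e.2 e'.2)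
  rw [contMDiffOn_iff_contDiffOn] at h
  have hmem : e.1 x ∈ (e.1.symm.trans e'.1).source := by
    simp [hx, hx']
  have hnhds := (e.1.symm.trans e'.1).open_source.mem_nhds hmem
  exact ((h.contDiffAt hnhds).analyticAt)

theorem ConformalMetric.normSq_eq (h : ConformalMetric X) (U : CubicDifferential X)
    (e : atlas ℂ X) {x : X} (hx : x ∈ e.1.source) :
    h.normSq U x = ‖U.coeff e (e.1 x)‖ ^ 2 / h.density e (e.1 x) ^ 3 := by
  have hU := U.transform (chart x) e x ⟨mem_chart_source' x, hx⟩
  have hρ := h.transform (chart x) e x ⟨mem_chart_source' x, hx⟩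
  have hpos := h.pos (chart x) _ ((chart x).1.map_source (mem_chart_source' x))
  rw [ConformalMetric.normSq, hU, hρ]
  rw [hρ] at hpos
  set d := ‖deriv (e.1 ∘ (chart x).1.symm) ((chart x).1 x)‖ with hd
  -- The transition derivative cannot vanish, since both densities are positive.
  have hd0 : d ≠ 0 := by
    rintro h0
    simp [h0] at hpos
  rw [norm_mul, norm_pow, ← hd, mul_pow, mul_pow, ← pow_mul, ← pow_mul]
  exact mul_div_mul_right _ _ (pow_ne_zero _ hd0)

namespace ConformalMetric

/-- The function `‖U‖² e^{-3u}`. -/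
def ratio (h : ConformalMetric X) (U : CubicDifferential X) (u : X → ℝ) (x : X) : ℝ :=
  h.normSq U x * Real.exp (-3 * u x)

/-- The expression of `log (‖U‖² e^{-3u})` in a chart. -/
def logRatio (h : ConformalMetric X) (U : CubicDifferential X) (u : X → ℝ) (e : atlas ℂ X)
    (z : ℂ) : ℝ :=
  2 * Real.log ‖U.coeff e z‖ - 3 * Real.log (h.density e z) - 3 * u (e.1.symm z)

variable {h : ConformalMetric X} {U : CubicDifferential X} {u : X → ℝ}

theorem normSq_nonneg (h : ConformalMetric X) (U : CubicDifferential X) (x : X) :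
    0 ≤ h.normSq U x := by
  have hpos := h.pos (chart x) _ ((chart x).1.map_source (mem_chart_source' x))
  rw [ConformalMetric.normSq]
  positivity

theorem ratio_nonneg (h : ConformalMetric X) (U : CubicDifferential X) (u : X → ℝ) (x : X) :
    0 ≤ h.ratio U u x := mul_nonneg (h.normSq_nonneg U x) (Real.exp_pos _).le

theorem coeff_ne_zero (e : atlas ℂ X) {x : X} (hx : x ∈ e.1.source) (h0 : 0 < h.ratio U u x) :
    U.coeff e (e.1 x) ≠ 0 := by
  intro hc
  rw [ratio, h.normSq_eq U e hx, hc] at h0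
  simp at h0

theorem ratio_pos (e : atlas ℂ X) {x : X} (hx : x ∈ e.1.source)
    (hc : U.coeff e (e.1 x) ≠ 0) : 0 < h.ratio U u x := by
  have hpos := h.pos e _ (e.1.map_source hx)
  have := norm_pos_iff.mpr hc
  rw [ratio, h.normSq_eq U e hx]
  positivity

theorem log_ratio_eq (e : atlas ℂ X) {x : X} (hx : x ∈ e.1.source)
    (hc : U.coeff e (e.1 x) ≠ 0) :
    Real.log (h.ratio U u x) = h.logRatio U u e (e.1 x) := by
  have hpos := h.pos e _ (e.1.map_source hx)
  have := norm_pos_iff.mpr hc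
  rw [ratio, h.normSq_eq U e hx, Real.log_mul (by positivity) (Real.exp_pos _).ne',
    Real.log_div (by positivity) (by positivity), Real.log_pow, Real.log_pow, Real.log_exp,
    logRatio, e.1.left_inv hx]
  push_cast
  ring

theorem continuous_ratio (hu : Continuous u) : Continuous (h.ratio U u) := by
  rw [continuous_iff_continuousAt]
  intro x
  set e := chart x with he
  have hx : x ∈ e.1.source := mem_chart_source' x
  have hT : e.1.target ∈ 𝓝 (e.1 x) := e.1.open_target.mem_nhds (e.1.map_source hx)
  have h1 : ContinuousAt (fun y => U.coeff e (e.1 y)) x :=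
    ((U.holomorphic e).continuousOn.continuousAt hT).comp (e.1.continuousAt hx)
  have h2 : ContinuousAt (fun y => h.density e (e.1 y)) x :=
    ((h.smooth e).continuousOn.continuousAt hT).comp (e.1.continuousAt hx)
  have hpos := h.pos e _ (e.1.map_source hx)
  have h3 : ContinuousAt (fun y => ‖U.coeff e (e.1 y)‖ ^ 2 / h.density e (e.1 y) ^ 3 *
      Real.exp (-3 * u y)) x :=
    ((h1.norm.pow 2).div (h2.pow 3) (pow_pos hpos 3).ne').mul
      (Real.continuous_exp.comp (hu.const_mul (-3))).continuousAt
  refine h3.congr ?_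
  filter_upwards [e.1.open_source.mem_nhds hx] with y hy
  rw [ratio, h.normSq_eq U e hy]

/-- `log |U(z)|` is harmonic off the zeros, and `-3 Δ log ρ = 6 ρ κ` cancels the curvature term in
`-3 Δ u`. What remains is `-6 ρ e^u + 12 ρ e^{-2u} ‖U‖²`, and `e^{-2u} = e^u e^{-3u}`. The preferred
chart at `x` is used because Wang's equation at `x` is written there. -/
theorem contDiffAt_and_laplacian_logRatio (hu : h.IsWangSolution U u) {x : X}
    (h0 : 0 < h.ratio U u x) :
    ContDiffAt ℝ 2 (h.logRatio U u (chart x)) ((chart x).1 x) ∧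
    Δ (h.logRatio U u (chart x)) ((chart x).1 x) =
      6 * (h.density (chart x) ((chart x).1 x) * Real.exp (u x)) * (2 * h.ratio U u x - 1) := by
  have hc : U.coeff (chart x) ((chart x).1 x) ≠ 0 := coeff_ne_zero _ (mem_chart_source' x) h0
  have heq := hu.2 x
  have hD : ContDiffAt ℝ 2 (u ∘ (chart x).1.symm) ((chart x).1 x) := by
    have := ((contMDiffAt_iff.mp (hu.1 x)).2)
    rw [modelWithCornersSelf_coe, Set.range_id, contDiffWithinAt_univ] at this
    exact this
  have hrat : h.ratio U u x = h.normSq U x * Real.exp (-3 * u x) := rfl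
  rw [laplacian, gaussCurvature] at heq
  set e := chart x with he
  have hx : x ∈ e.1.source := mem_chart_source' x
  have hT : e.1.target ∈ 𝓝 (e.1 x) := e.1.open_target.mem_nhds (e.1.map_source hx)
  have hpos := h.pos e _ (e.1.map_source hx)
  have hA := ((U.holomorphic e).analyticAt hT).harmonicAt_log_norm hc
  have hB : ContDiffAt ℝ 2 (fun z => Real.log (h.density e z)) (e.1 x) :=
    (contDiffAt_infty.mp ((h.smooth e).contDiffAt hT) 2).log hpos.ne'
  have hsum : h.logRatio U u e = ((2 : ℝ) • fun z => Real.log ‖U.coeff e z‖) +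
      ((-3 : ℝ) • fun z => Real.log (h.density e z)) + ((-3 : ℝ) • (u ∘ e.1.symm)) := by
    funext z
    simp [logRatio]
    ring
  have cA : ContDiffAt ℝ 2 ((2 : ℝ) • fun z => Real.log ‖U.coeff e z‖) (e.1 x) := hA.1.const_smul (2 : ℝ)
  have cB : ContDiffAt ℝ 2 ((-3 : ℝ) • fun z => Real.log (h.density e z)) (e.1 x) :=
    hB.const_smul (-3 : ℝ)
  have cD : ContDiffAt ℝ 2 ((-3 : ℝ) • (u ∘ e.1.symm)) (e.1 x) := hD.const_smul (-3 : ℝ)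
  have cAB : ContDiffAt ℝ 2 (((2 : ℝ) • fun z => Real.log ‖U.coeff e z‖) +
      ((-3 : ℝ) • fun z => Real.log (h.density e z))) (e.1 x) := cA.add cB
  rw [hsum]
  refine ⟨cAB.add cD, ?_⟩
  rw [cAB.laplacian_add cD, cA.laplacian_add cB, InnerProductSpace.laplacian_smul _ hA.1,
    InnerProductSpace.laplacian_smul _ hB, InnerProductSpace.laplacian_smul _ hD,
    hA.2.self_of_nhds, hrat]
  have hexp : Real.exp (-2 * u x) = Real.exp (u x) * Real.exp (-3 * u x) := by
    rw [← Real.exp_add]; ring_nf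
  rw [hexp] at heq
  simp only [Pi.zero_apply, smul_eq_mul]
  generalize Real.exp (-3 * u x) = E at heq ⊢
  field_simp at heq
  linear_combination (-3 : ℝ) * heq

/-- Maximum principle at a global maximum of the ratio. If the maximum is zero the bound is trivial;
otherwise the point is not a zero of `U` and the logarithm is smooth there. -/
theorem IsWangSolution.ratio_le_half [CompactSpace X] (hu : h.IsWangSolution U u) (x : X) :
    h.ratio U u x ≤ 1 / 2 := by
  have hcont := continuous_ratio (h := h) (U := U) hu.1.continuous
  have : Nonempty X := ⟨x⟩
  obtain ⟨y, -, hy⟩ := isCompact_univ.exists_isMaxOn Set.univ_nonempty hcont.continuousOn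
  have hmax : ∀ z, h.ratio U u z ≤ h.ratio U u y := fun z => hy (Set.mem_univ z)
  refine (hmax x).trans ?_
  rcases (h.ratio_nonneg U u y).eq_or_lt with h0 | h0
  · rw [← h0]; norm_num
  obtain ⟨hC, hL⟩ := contDiffAt_and_laplacian_logRatio hu h0
  have hys := mem_chart_source' y
  have hpos := h.pos (chart y) _ ((chart y).1.map_source hys)
  have hloc : IsLocalMax (h.logRatio U u (chart y)) ((chart y).1 y) := by
    have hT := (chart y).1.open_target.mem_nhds ((chart y).1.map_source hys)
    have hne := ((U.holomorphic (chart y)).continuousOn.continuousAt hT).eventually_ne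
      (coeff_ne_zero _ hys h0)
    filter_upwards [hT, hne] with z hz hcz
    have hzs := (chart y).1.map_target hz
    have hzr := (chart y).1.right_inv hz
    rw [← hzr] at hcz
    have hpz : 0 < h.ratio U u ((chart y).1.symm z) := ratio_pos _ hzs hcz
    have := Real.log_le_log hpz (hmax ((chart y).1.symm z))
    rwa [log_ratio_eq _ hzs hcz, log_ratio_eq _ hys (coeff_ne_zero _ hys h0), hzr] at this
  have hle := hloc.laplacian_nonpos hC
  rw [hL] at hle
  by_contra! hcon
  have : 0 < 6 * (h.density (chart y) ((chart y).1 y) * Real.exp (u y)) *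
      (2 * h.ratio U u y - 1) := by
    have : 0 < 2 * h.ratio U u y - 1 := by linarith
    have := Real.exp_pos (u y)
    positivity
  linarith

end ConformalMetric

end RiemannSurface

/-! ### The interior estimate and the lower bound. -/

namespace RiemannSurface

namespace ConformalMetric

variable {X : Type*} [TopologicalSpace X] [ChartedSpace ℂ X] [IsManifold 𝓘(ℂ, ℂ) ω X]
  {h : ConformalMetric X} {U : CubicDifferential X} {u : X → ℝ}

/-- If `-log (2 ‖U‖² e^{-3u})` is touched from above at `x` by a multiple of the barrier of a
coordinate disc, its value there is controlled. -/
theorem sq_neg_log_ratio_le_of_isMaxOn [CompactSpace X] (hu : h.IsWangSolution U u)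
    (e : atlas ℂ X) {c : ℂ} {R k M : ℝ} (hk : 0 < k) (hM : 0 ≤ M) {x : X} (hx : x ∈ e.1.source)
    (hxR : ‖e.1 x - c‖ < R) (hUx : k ^ 3 ≤ 2 * ‖U.coeff e (e.1 x)‖ ^ 2)
    (hmax : ∀ᶠ y in 𝓝 x, -Real.log (2 * h.ratio U u y) ≤
      M * ((R ^ 2 - ‖e.1 y - c‖ ^ 2) ^ 2)⁻¹)
    (hxM : -Real.log (2 * h.ratio U u x) = M * ((R ^ 2 - ‖e.1 x - c‖ ^ 2) ^ 2)⁻¹) :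
    k * (-Real.log (2 * h.ratio U u x)) ^ 2 ≤
      96 * M * R ^ 2 / (R ^ 2 - ‖e.1 x - c‖ ^ 2) ^ 4 := by
  have hk3 : 0 < k ^ 3 := pow_pos hk 3
  have hce : U.coeff e (e.1 x) ≠ 0 := by
    intro h0
    rw [h0] at hUx
    simp at hUx
    linarith
  have h0 : 0 < h.ratio U u x := ratio_pos e hx hce
  obtain ⟨hC, hL⟩ := contDiffAt_and_laplacian_logRatio hu h0
  have hρ := h.transform (chart x) e x ⟨mem_chart_source' x, hx⟩
  have hpos₁ := h.pos (chart x) _ ((chart x).1.map_source (mem_chart_source' x))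
  have hpos := h.pos e _ (e.1.map_source hx)
  have hτ := analyticAt_transition (chart x) e (mem_chart_source' x) hx
  set e₁ := chart x with he₁
  have hx₁ : x ∈ e₁.1.source := mem_chart_source' x
  -- The barrier lives in the chart `e` of the disc, the equation in the preferred chart at `x`; the
  -- barrier is pulled back by the holomorphic transition `τ`.
  set τ := e.1 ∘ e₁.1.symm with hτ_def
  have hτx : τ (e₁.1 x) = e.1 x := by simp [hτ_def, e₁.1.left_inv hx₁]
  set b : ℂ → ℝ := fun z => ((R ^ 2 - ‖z - c‖ ^ 2) ^ 2)⁻¹ with hb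
  have hbC : ContDiffAt ℝ 2 b (τ (e₁.1 x)) := by rw [hτx]; exact contDiffAt_disc_barrier hxR
  have hbτ : ContDiffAt ℝ 2 (b ∘ τ) (e₁.1 x) :=
    hbC.comp _ ((hτ.contDiffAt (n := 2)).restrict_scalars ℝ)
  have hlap : Δ (b ∘ τ) (e₁.1 x) = ‖deriv τ (e₁.1 x)‖ ^ 2 * Δ b (e.1 x) := by
    rw [laplacian_comp_analyticAt hτ hbC, hτx]
  have hbound : Δ b (e.1 x) ≤ 32 * R ^ 2 / (R ^ 2 - ‖e.1 x - c‖ ^ 2) ^ 4 :=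
    laplacian_disc_barrier_le hxR
  have hlogx : -Real.log (2 * h.ratio U u x) = -Real.log 2 - h.logRatio U u e₁ (e₁.1 x) := by
    rw [Real.log_mul (by norm_num) h0.ne', log_ratio_eq e₁ hx₁ (coeff_ne_zero e₁ hx₁ h0)]
    ring
  have hloc : IsLocalMax (-h.logRatio U u e₁ - M • (b ∘ τ)) (e₁.1 x) := by
    have hT := e₁.1.open_target.mem_nhds (e₁.1.map_source hx₁)
    have hne := ((U.holomorphic e₁).continuousOn.continuousAt hT).eventually_ne
      (coeff_ne_zero _ hx₁ h0)
    have hsymm : Tendsto e₁.1.symm (𝓝 (e₁.1 x)) (𝓝 x) := e₁.1.tendsto_symm hx₁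
    filter_upwards [hT, hne, hsymm.eventually hmax] with w hw hcw hwmax
    have hws := e₁.1.map_target hw
    have hwr := e₁.1.right_inv hw
    rw [← hwr] at hcw
    have hpw : 0 < h.ratio U u (e₁.1.symm w) := ratio_pos _ hws hcw
    rw [Real.log_mul (by norm_num) hpw.ne', log_ratio_eq _ hws hcw, hwr] at hwmax
    rw [hlogx] at hxM
    simp only [Pi.sub_apply, Pi.neg_apply, Pi.smul_apply, smul_eq_mul, Function.comp_apply, hτx]
    have e1 : b (τ w) = ((R ^ 2 - ‖e.1 (e₁.1.symm w) - c‖ ^ 2) ^ 2)⁻¹ := rfl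
    have e2 : b (e.1 x) = ((R ^ 2 - ‖e.1 x - c‖ ^ 2) ^ 2)⁻¹ := rfl
    rw [e1, e2]
    linarith
  have hle := hloc.laplacian_nonpos (hC.neg.sub (hbτ.const_smul M))
  have hMb : ContDiffAt ℝ 2 (M • (b ∘ τ)) (e₁.1 x) := hbτ.const_smul M
  have hCn : ContDiffAt ℝ 2 (-h.logRatio U u e₁) (e₁.1 x) := hC.neg
  rw [hCn.laplacian_sub hMb, InnerProductSpace.laplacian_neg,
    InnerProductSpace.laplacian_smul _ hbτ, Pi.neg_apply, hL, hlap, hρ, smul_eq_mul] at hle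
  set d := ‖deriv τ (e₁.1 x)‖ ^ 2 with hd
  rw [hρ] at hpos₁
  have hd0 : 0 < d := pos_of_mul_pos_right hpos₁ hpos.le
  set f := -Real.log (2 * h.ratio U u x) with hf
  set P := h.density e (e.1 x) * Real.exp (u x) with hP_def
  have hP : 0 < P := mul_pos hpos (Real.exp_pos _)
  have hef : Real.exp (-f) = 2 * h.ratio U u x := by
    rw [hf, neg_neg, Real.exp_log (by positivity)]
  have hf0 : 0 ≤ f := by
    have := Real.log_nonpos (by positivity)
      (show 2 * h.ratio U u x ≤ 1 by linarith [hu.ratio_le_half x])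
    linarith
  have hP3 : k ^ 3 * Real.exp f ≤ P ^ 3 := by
    -- `P³ T = |U(z)|²` and `2T = e^{-f}`.
    have h1 : P ^ 3 = 2 * ‖U.coeff e (e.1 x)‖ ^ 2 * Real.exp f := by
      have h2 : Real.exp f * (2 * h.ratio U u x) = 1 := by
        rw [← hef, ← Real.exp_add]; simp
      have h3 : Real.exp (u x) ^ 3 * Real.exp (-3 * u x) = 1 := by
        rw [← Real.exp_nat_mul, ← Real.exp_add]; simp
      rw [ratio, h.normSq_eq U e hx] at h2
      have h4 : P ^ 3 * (‖U.coeff e (e.1 x)‖ ^ 2 / h.density e (e.1 x) ^ 3 *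
          Real.exp (-3 * u x)) = ‖U.coeff e (e.1 x)‖ ^ 2 := by
        rw [hP_def, mul_pow]
        generalize Real.exp (-3 * u x) = E at h3 ⊢
        field_simp
        linear_combination h3
      linear_combination (-P ^ 3) * h2 + 2 * Real.exp f * h4
    rw [h1]
    gcongr
  have hQ : P * (1 - Real.exp (-f)) ≤
      (32 * R ^ 2 / (R ^ 2 - ‖e.1 x - c‖ ^ 2) ^ 4) * M / 6 := by
    rw [hef]
    -- Both Laplacians carry the conformal factor `d`, which divides out and leaves an inequality in
    -- the chart `e`.
    have h1 : d * (6 * P * (1 - 2 * h.ratio U u x) - M * Δ b (e.1 x)) ≤ 0 := by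
      rw [hP_def]
      linarith
    have h2 := nonpos_of_mul_nonpos_right h1 hd0
    have h3 := mul_le_mul_of_nonneg_left hbound hM
    linarith
  refine (sq_le_of_exp_bound hP hk hf0 hP3 hQ).trans (le_of_eq ?_)
  ring

/-- The interior estimate for `-log (2 ‖U‖² e^{-3u})` at the centre of a coordinate disc. -/
theorem neg_log_ratio_le_of_closedBall [CompactSpace X] (hu : h.IsWangSolution U u)
    (e : atlas ℂ X) {c : ℂ} {R k : ℝ} (hR : 0 < R) (hk : 0 < k)
    (hball : Metric.closedBall c R ⊆ e.1.target)
    (hU : ∀ z ∈ Metric.closedBall c R, k ^ 3 ≤ 2 * ‖U.coeff e z‖ ^ 2) :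
    -Real.log (2 * h.ratio U u (e.1.symm c)) ≤ 96 / (k * R ^ 2) := by
  have hratio : ∀ z ∈ Metric.closedBall c R, 0 < h.ratio U u (e.1.symm z) := by
    intro z hz
    refine ratio_pos e (e.1.map_target (hball hz)) ?_
    rw [e.1.right_inv (hball hz)]
    intro h0
    have h1 := hU z hz
    have := pow_pos hk 3
    rw [h0] at h1
    simp at h1
    linarith
  set f : ℂ → ℝ := fun z => -Real.log (2 * h.ratio U u (e.1.symm z)) with hf
  have hfcont : ContinuousOn f (Metric.closedBall c R) := by
    have h1 : ContinuousOn (fun z => 2 * h.ratio U u (e.1.symm z)) (Metric.closedBall c R) :=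
      continuousOn_const.mul ((continuous_ratio hu.1.continuous).comp_continuousOn
        (e.1.continuousOn_symm.mono hball))
    exact (h1.log fun z hz => (mul_pos two_pos (hratio z hz)).ne').neg
  have hcont : ContinuousOn (fun z => f z * (R ^ 2 - ‖z - c‖ ^ 2) ^ 2) (Metric.closedBall c R) :=
    hfcont.mul (by fun_prop)
  have hc : c ∈ Metric.closedBall c R := Metric.mem_closedBall_self hR.le
  -- The maximum `M` of `f` times the inverse barrier is the multiple for which `M (R² - |z -
  -- c|²)⁻²` touches `f` from above at the maximum point.
  obtain ⟨z, hz, hzmax⟩ := (isCompact_closedBall c R).exists_isMaxOn ⟨c, hc⟩ hcont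
  set M := f z * (R ^ 2 - ‖z - c‖ ^ 2) ^ 2 with hM
  have hcM : f c * R ^ 4 ≤ M := by
    have : f c * (R ^ 2 - ‖c - c‖ ^ 2) ^ 2 ≤ M := hzmax hc
    simp only [sub_self, norm_zero] at this
    linarith
  have hR4 : 0 < R ^ 4 := pow_pos hR 4
  change f c ≤ _
  rcases le_or_gt M 0 with hM0 | hM0
  · have h1 : f c ≤ 0 := by
      by_contra! h2
      have := mul_pos h2 hR4
      linarith
    exact h1.trans (by positivity)
  -- The weight vanishes on the boundary circle, so a positive maximum is interior.
  have hzR : ‖z - c‖ < R := by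
    refine lt_of_le_of_ne (by simpa [dist_eq_norm] using hz) fun h1 => ?_
    rw [hM, h1] at hM0
    simp at hM0
  have hs : 0 < R ^ 2 - ‖z - c‖ ^ 2 := by nlinarith [norm_nonneg (z - c)]
  have hzT := hball hz
  have hzr := e.1.right_inv hzT
  have hzs := e.1.map_target hzT
  have hfz : f z = M * ((R ^ 2 - ‖z - c‖ ^ 2) ^ 2)⁻¹ := by
    rw [hM]; field_simp
  have key := sq_neg_log_ratio_le_of_isMaxOn (h := h) (U := U) hu e (c := c) (R := R) hk hM0.le hzs
    (by rwa [hzr]) (by rw [hzr]; exact hU z hz) ?_ (by rw [hzr]; exact hfz)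
  · rw [hzr] at key
    change k * f z ^ 2 ≤ _ at key
    rw [hfz] at key
    set s := R ^ 2 - ‖z - c‖ ^ 2
    -- Both sides of `key` carry `s⁻⁴`, so the bound on `M` does not depend on where the maximum is
    -- attained.
    have h1 : k * M ≤ 96 * R ^ 2 := by
      have h2 : M * (k * M) / s ^ 4 ≤ M * (96 * R ^ 2) / s ^ 4 := by
        calc M * (k * M) / s ^ 4 = k * (M * (s ^ 2)⁻¹) ^ 2 := by field_simp
          _ ≤ 96 * M * R ^ 2 / s ^ 4 := key
          _ = M * (96 * R ^ 2) / s ^ 4 := by ring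
      exact le_of_mul_le_mul_left ((div_le_div_iff_of_pos_right (pow_pos hs 4)).mp h2) hM0
    rw [le_div_iff₀ (by positivity)]
    have h3 : k * (f c * R ^ 4) ≤ 96 * R ^ 2 := (mul_le_mul_of_nonneg_left hcM hk.le).trans h1
    have h4 : f c * (k * R ^ 2) * R ^ 2 ≤ 96 * R ^ 2 := by linarith
    exact le_of_mul_le_mul_right h4 (by positivity)
  · have h1 : ∀ᶠ y in 𝓝 (e.1.symm z), e.1 y ∈ Metric.ball c R :=
      (e.1.continuousAt hzs).eventually (Metric.isOpen_ball.mem_nhds (by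
        rw [hzr]; simpa [dist_eq_norm] using hzR))
    filter_upwards [h1, e.1.open_source.mem_nhds hzs] with y hy hys
    have h2 : f (e.1 y) * (R ^ 2 - ‖e.1 y - c‖ ^ 2) ^ 2 ≤ M :=
      hzmax (Metric.ball_subset_closedBall hy)
    have hyR : ‖e.1 y - c‖ < R := by simpa [dist_eq_norm] using hy
    have h3 : 0 < R ^ 2 - ‖e.1 y - c‖ ^ 2 := by nlinarith [norm_nonneg (e.1 y - c)]
    rw [← div_eq_mul_inv, le_div_iff₀ (by positivity)]
    simpa only [hf, e.1.left_inv hys] using h2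

theorem half_sub_neg_log_le_ratio {T : ℝ} (hT : 0 < T) :
    1 / 2 - -Real.log (2 * T) / 2 ≤ T := by
  have := Real.log_le_sub_one_of_pos (show 0 < 2 * T by positivity)
  linarith

/-- The lower bound near a point which is not a zero of `U₀`. -/
theorem exists_nhds_ratio_lower_bound [CompactSpace X] (U₀ : CubicDifferential X) {x₀ : X}
    (hx₀ : ¬ U₀.IsZeroAt x₀) :
    ∃ V ∈ 𝓝 x₀, ∃ C : ℝ, ∀ (h : ConformalMetric X) (lam : ℝ), 0 < lam →
      ∀ u : X → ℝ, h.IsWangSolution ((lam : ℂ) • U₀) u →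
        ∀ x ∈ V, 1 / 2 - C * lam ^ (-(2 / 3) : ℝ) ≤ h.ratio ((lam : ℂ) • U₀) u x := by
  set e := chart x₀ with he
  have hxs : x₀ ∈ e.1.source := mem_chart_source' x₀
  have hT := e.1.open_target.mem_nhds (e.1.map_source hxs)
  have hn0 : 0 < ‖U₀.coeff e (e.1 x₀)‖ := norm_pos_iff.mpr hx₀
  set m := ‖U₀.coeff e (e.1 x₀)‖ / 2 with hm
  have hm0 : 0 < m := by positivity
  have hev : ∀ᶠ z in 𝓝 (e.1 x₀), m < ‖U₀.coeff e z‖ :=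
    ((U₀.holomorphic e).continuousOn.continuousAt hT).norm.eventually
      (lt_mem_nhds (by simp only [hm]; linarith))
  obtain ⟨r, hr, hrsub⟩ := Metric.mem_nhds_iff.mp (Filter.inter_mem hT hev)
  -- With half the radius, every disc of radius `R` centred in the `R`-ball stays in the `r`-ball,
  -- so one `R` serves a whole neighbourhood.
  set R := r / 2 with hRdef
  have hR : 0 < R := by positivity
  set κ := (2 * m ^ 2) ^ (1 / 3 : ℝ) with hκ
  have hκ0 : 0 < κ := by positivity
  have hκ3 : κ ^ 3 = 2 * m ^ 2 := by
    rw [hκ, ← Real.rpow_natCast, ← Real.rpow_mul (by positivity)]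
    norm_num
  refine ⟨e.1.source ∩ e.1 ⁻¹' Metric.ball (e.1 x₀) R,
    Filter.inter_mem (e.1.open_source.mem_nhds hxs)
      ((e.1.continuousAt hxs).preimage_mem_nhds (Metric.ball_mem_nhds _ hR)),
    -- Half of `96 / (κ R²)`, because `T ≥ 1/2 - f/2`.
    48 / (κ * R ^ 2), ?_⟩
  rintro h lam hlam u hu x ⟨hx, hxR⟩
  have hsub : ∀ z ∈ Metric.closedBall (e.1 x) R, z ∈ e.1.target ∧ m < ‖U₀.coeff e z‖ := by
    intro z hz
    refine hrsub ?_
    have h1 : dist (e.1 x) (e.1 x₀) < R := hxR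
    have h2 : dist z (e.1 x) ≤ R := hz
    have := dist_triangle z (e.1 x) (e.1 x₀)
    rw [Metric.mem_ball]
    linarith
  have hl0 : 0 < lam ^ (2 / 3 : ℝ) := by positivity
  have hl3 : (lam ^ (2 / 3 : ℝ)) ^ 3 = lam ^ 2 := by
    rw [← Real.rpow_natCast, ← Real.rpow_mul hlam.le]
    norm_num
  have hcoeff : ∀ z, ‖((lam : ℂ) • U₀).coeff e z‖ = lam * ‖U₀.coeff e z‖ := by
    intro z
    change ‖(lam : ℂ) * U₀.coeff e z‖ = _
    rw [norm_mul, Complex.norm_of_nonneg hlam.le]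
  -- `k³ = 2 m² λ²`, a lower bound for `2 |λ U₀(z)|²` on the disc.
  have key := neg_log_ratio_le_of_closedBall hu e (c := e.1 x) hR
    (k := κ * lam ^ (2 / 3 : ℝ)) (by positivity) (fun z hz => (hsub z hz).1) (fun z hz => by
      rw [mul_pow, hκ3, hl3, hcoeff, mul_pow]
      have := pow_le_pow_left₀ hm0.le (hsub z hz).2.le 2
      nlinarith [sq_nonneg lam])
  rw [e.1.left_inv hx] at key
  have hpos : 0 < h.ratio ((lam : ℂ) • U₀) u x := by
    refine ratio_pos e hx (norm_pos_iff.mp ?_)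
    rw [hcoeff]
    exact mul_pos hlam (hm0.trans (hsub _ (Metric.mem_closedBall_self hR.le)).2)
  have hfin := half_sub_neg_log_le_ratio hpos
  have heq : 48 / (κ * R ^ 2) * lam ^ (-(2 / 3) : ℝ) =
      96 / (κ * lam ^ (2 / 3 : ℝ) * R ^ 2) / 2 := by
    rw [Real.rpow_neg hlam.le]
    field_simp
    norm_num
  rw [heq]
  linarith

end ConformalMetric

end RiemannSurface

end

/-! ### Uniformity over the compact set. -/

theorem mainTheorem3 {X : Type*} [TopologicalSpace X] [T2Space X] [CompactSpace X]
    [ConnectedSpace X] [ChartedSpace ℂ X] [IsManifold 𝓘(ℂ, ℂ) ω X]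
    (hgenus : 1 < RiemannSurface.genus X)
    (U₀ : RiemannSurface.CubicDifferential X) (hU₀ : ∃ x, ¬ U₀.IsZeroAt x)
    (K : Set X) (hK : IsCompact K) (hKU₀ : ∀ x ∈ K, ¬ U₀.IsZeroAt x) :
    ∃ C : ℝ, ∀ (h : RiemannSurface.ConformalMetric X) (lam : ℝ), 0 < lam →
      ∀ u : X → ℝ, h.IsWangSolution ((lam : ℂ) • U₀) u →
        ∀ x ∈ K,
          h.normSq ((lam : ℂ) • U₀) x * Real.exp (-3 * u x) ≤ 1 / 2 ∧
          1 / 2 - C * lam ^ (-(2 / 3) : ℝ) ≤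
            h.normSq ((lam : ℂ) • U₀) x * Real.exp (-3 * u x) := by
  suffices hlow : ∃ C : ℝ, ∀ (h : RiemannSurface.ConformalMetric X) (lam : ℝ), 0 < lam →
      ∀ u : X → ℝ, h.IsWangSolution ((lam : ℂ) • U₀) u →
        ∀ x ∈ K, 1 / 2 - C * lam ^ (-(2 / 3) : ℝ) ≤ h.ratio ((lam : ℂ) • U₀) u x by
    obtain ⟨C, hC⟩ := hlow
    exact ⟨C, fun h lam hlam u hu x hx => ⟨hu.ratio_le_half x, hC h lam hlam u hu x hx⟩⟩
  -- The existence of a constant passes to subsets and to unions (larger constant), and holds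
  -- locally.
  refine hK.induction_on (p := fun S => ∃ C : ℝ, ∀ (h : RiemannSurface.ConformalMetric X)
      (lam : ℝ), 0 < lam → ∀ u : X → ℝ, h.IsWangSolution ((lam : ℂ) • U₀) u →
        ∀ x ∈ S, 1 / 2 - C * lam ^ (-(2 / 3) : ℝ) ≤ h.ratio ((lam : ℂ) • U₀) u x) ?_ ?_ ?_ ?_
  · exact ⟨0, fun _ _ _ _ _ x hx => hx.elim⟩
  · rintro S S' hSS' ⟨C, hC⟩
    exact ⟨C, fun h lam hlam u hu x hx => hC h lam hlam u hu x (hSS' hx)⟩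
  · rintro S S' ⟨C, hC⟩ ⟨C', hC'⟩
    refine ⟨max C C', fun h lam hlam u hu x hx => ?_⟩
    have hl : 0 ≤ lam ^ (-(2 / 3) : ℝ) := Real.rpow_nonneg hlam.le _
    rcases hx with hx | hx
    · have := mul_le_mul_of_nonneg_right (le_max_left C C') hl
      linarith [hC h lam hlam u hu x hx]
    · have := mul_le_mul_of_nonneg_right (le_max_right C C') hl
      linarith [hC' h lam hlam u hu x hx]
  · intro x hx
    obtain ⟨V, hV, hC⟩ :=
      RiemannSurface.ConformalMetric.exists_nhds_ratio_lower_bound U₀ (hKU₀ x hx)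
    exact ⟨V, mem_nhdsWithin_of_mem_nhds hV, hC⟩
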